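/- Let $G$ be a Lie group of dimension $n\ge 1$ with a left-invariant Finsler metric, that is, a left-invariant family of norms on the tangent spaces, continuous on the tangent bundle. Let $d(x,y)\in[0,\infty]$ be the induced distance, the infimum of the lengths of $C^1$ paths from $x$ to $y$ (so $d(x,y)=\infty$ if $x$ and $y$ lie in different connected components). Let $\mathcal H^n$ be the Hausdorff $n$-measure of $(G,d)$, and let $B(x,r)=\{y\in G: d(x,y)\le r\}$ denote closed balls. Let $n<p<\infty$. Then there is a constant $C>0$, depending only on $p$, $G$ and the Finsler metric, with the following property. Let $u:G\to[-\infty,\infty]$ be a function which has an upper gradient $g\in L^p(G,\mathcal H^n)$; that is, $g:G\to[0,\infty]$ is a Borel function with $\int_G g^p\,d\mathcal H^n<\infty$ and $$|u(\gamma(a))-u(\gamma(b))|\le\int_\gamma g\,ds$$ for every nonconstant rectifiable path $\gamma:[a,b]\to G$. Then for all $x,y\in G$ with $d(x,y)\le 1$, $$|u(x)-u(y)|\le C\,d(x,y)^{1-n/p}\Big(\int_{B(x,\,C\,d(x,y))}g^p\,d\mathcal H^n\Big)^{1/p}.$$ Here $|u(x)-u(y)|$ is understood to be $\infty$ if $u(x)$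 or $u(y)$ is infinite; in particular, $u$ is finite everywhere. -/

import Mathlib

open Set MeasureTheory
open scoped Manifold ContDiff ENNReal Topology

noncomputable section

/-- A (reversible) Finsler metric on a manifold: a norm on every tangent space, depending
continuously on the tangent vector as a function on the tangent bundle. -/
structure FinslerMetric {E : Type*} [NormedAddCommGroup E] [NormedSpace ℝ E]
    {H : Type*} [TopologicalSpace H] (I : ModelWithCorners ℝ E H)
    (M : Type*) [TopologicalSpace M] [ChartedSpace H M] [IsManifold I 1 M] where
  /-- The norm on each tangent space. -/
  norm : ∀ x : M, Seminorm ℝ (TangentSpace I x)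
  pos_of_ne_zero : ∀ (x : M) (v : TangentSpace I x), v ≠ 0 → 0 < norm x v
  continuous_norm : Continuous fun w : TangentBundle I M => norm w.proj w.snd

namespace FinslerMetric

/-- The norms of a Finsler metric, with values in `[0, ∞]`. -/
@[reducible] def toENorm {E : Type*} [NormedAddCommGroup E] [NormedSpace ℝ E]
    {H : Type*} [TopologicalSpace H] {I : ModelWithCorners ℝ E H}
    {M : Type*} [TopologicalSpace M] [ChartedSpace H M] [IsManifold I 1 M]
    (F : FinslerMetric I M) (x : M) : ENorm (TangentSpace I x) :=
  ⟨fun v => ENNReal.ofReal (F.norm x v)⟩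

/-- The distance coming from a Finsler metric: the infimum of the lengths
`∫ F(γ(t), γ'(t)) dt` over all `C^1` paths `γ` from `x` to `y`. It is `∞` if `x` and `y` lie in
different connected components. (Mathlib's `Manifold.riemannianEDist` is defined for an arbitrary
family of norms on the tangent spaces, not only for those that come from inner products.) -/
def finslerEDist {E : Type*} [NormedAddCommGroup E] [NormedSpace ℝ E]
    {H : Type*} [TopologicalSpace H] {I : ModelWithCorners ℝ E H}
    {M : Type*} [TopologicalSpace M] [ChartedSpace H M] [IsManifold I 1 M]
    (F : FinslerMetric I M) (x y : M) : ℝ≥0∞ :=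
  letI : ∀ z : M, ENorm (TangentSpace I z) := F.toENorm
  Manifold.riemannianEDist I x y

/-- A Finsler metric on a Lie group is left-invariant if the differential of every left
translation is an isometry between the tangent spaces. -/
def IsLeftInvariant {E : Type*} [NormedAddCommGroup E] [NormedSpace ℝ E]
    {H : Type*} [TopologicalSpace H] {I : ModelWithCorners ℝ E H}
    {G : Type*} [TopologicalSpace G] [ChartedSpace H G] [IsManifold I 1 G] [Group G]
    (F : FinslerMetric I G) : Prop :=
  ∀ (a x : G) (v : TangentSpace I x),
    F.norm (a * x) (mfderiv I I (fun z : G => a * z) x v) = F.norm x v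

end FinslerMetric

/-- `|a - b|` for `a, b` in `[-∞, ∞]`, with value `∞` as soon as `a` or `b` is infinite
(see `absDiff_eq_top_iff`). -/
def absDiff (a b : EReal) : ℝ≥0∞ := (a - b).abs

theorem absDiff_coe (a b : ℝ) : absDiff (a : EReal) (b : EReal) = ENNReal.ofReal |a - b| := by
  rw [absDiff, ← EReal.coe_sub, EReal.abs_def]

theorem absDiff_eq_top_iff (a b : EReal) :
    absDiff a b = (⊤ : ℝ≥0∞) ↔ (a = ⊤ ∨ a = ⊥) ∨ (b = ⊤ ∨ b = ⊥) := by
  induction a <;> induction b <;> simp [absDiff, ← EReal.coe_sub, EReal.abs_def]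

/-- The integral `∫_γ ρ ds` of `ρ` along a rectifiable curve `γ : [a, b] → X`, computed in the
arc length parametrization of `γ`, which is defined on `[0, ℓ(γ)]`. -/
def arcLengthIntegral {X : Type*} [PseudoEMetricSpace X] (ρ : X → ℝ≥0∞) (γ : ℝ → X) (a b : ℝ) :
    ℝ≥0∞ :=
  ∫⁻ s in Icc 0 (eVariationOn γ (Icc a b)).toReal, ρ (naturalParameterization γ (Icc a b) a s)

/-- `g : X → [0, ∞]` is an upper gradient of `u : X → [-∞, ∞]` if it is Borel and
`|u(γ(a)) - u(γ(b))| ≤ ∫_γ g ds` for every nonconstant rectifiable curve `γ : [a, b] → X`.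
The left-hand side is `∞` if `u` is infinite at an endpoint of `γ`. -/
structure IsUpperGradient {X : Type*} [PseudoEMetricSpace X] [MeasurableSpace X]
    (u : X → EReal) (g : X → ℝ≥0∞) : Prop where
  measurable : Measurable g
  absDiff_le : ∀ (γ : ℝ → X) (a b : ℝ), a ≤ b → ContinuousOn γ (Icc a b) →
    eVariationOn γ (Icc a b) ≠ (⊤ : ℝ≥0∞) → (∃ t ∈ Icc a b, γ t ≠ γ a) →
    absDiff (u (γ a)) (u (γ b)) ≤ arcLengthIntegral g γ a b

/-- The norm `‖g‖_{p, A} = (∫_A g ^ p dμ) ^ (1 / p)` of a function `g` with values in `[0, ∞]`. -/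
def lpNormOn {X : Type*} [MeasurableSpace X] (μ : Measure X) (p : ℝ) (A : Set X)
    (g : X → ℝ≥0∞) : ℝ≥0∞ :=
  (∫⁻ z in A, g z ^ p ∂μ) ^ (1 / p)

end

/-!
The estimate is Morrey's inequality, transported to the group by bilipschitz charts.

*From the group to Euclidean balls.* Read in a chart, the Finsler metric is a continuous family of
norms, hence comparable with the norm of the model space near the base point. Lengths of paths are
therefore comparable too, and since short paths cannot leave the chart, the inverse of the chart is
bilipschitz on a small ball (`FinslerMetric.exists_bilipschitz_param`). Left translations preserve
the distance (`FinslerMetric.IsLeftInvariant.finslerEDist_mul_left`), so one parametrization `ψ`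
of a neighborhood of the identity gives parametrizations `a ↦ x * ψ a` around all points, with the
same constants.

*Morrey's inequality on a ball.* Let `B` be a ball of radius `r` in `Fin n → ℝ` with center `0`, and
`b ∈ B`. For `z ∈ B`, the images of the segments from `0` to `z` and from `b` to `z` are Lipschitz
curves, and the upper gradient inequality bounds `|u(ψ 0) - u(ψ b)|` by `r` times the integrals of
`g ∘ ψ` over these segments. Averaging over `z ∈ B`, exchanging the integrals, and applying
Hölder's inequality to the contraction by the factor `t`, which costs `t ^ (-n / p)`, gives
`r ^ (1 - n / p) * ‖g ∘ ψ‖_p` up to a constant, as `t ^ (-n / p)` is integrable for `n < p`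
(`lintegral_segments_le`, `IsUpperGradient.absDiff_le_of_bilipschitz`). The Lebesgue measure of
`Fin n → ℝ` is its Hausdorff `n`-measure, and the latter is distorted by `ψ` at most by a constant
factor (`lintegral_comp_le_hausdorffMeasure`).

*From small to bounded distances.* This proves the estimate for `d(x, y) ≤ δ`
(`exists_absDiff_le_of_edist_le`). If `δ ≤ d(x, y) ≤ 1`, then a path of length less than `2` from
`x` to `y` is cut into a bounded number of pieces whose endpoints are at distance at most `δ`
(`FinslerMetric.le_natCast_mul_of_length_le`). For `x = y` the claim says that `u x` is finite,
which follows from the estimate for `x` and a nearby point.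
-/

open scoped NNReal

/-! ### Lengths of paths and Finsler metrics in charts -/

namespace FinslerMetric

section Chart

variable {E : Type*} [NormedAddCommGroup E] [NormedSpace ℝ E]
  {M : Type*} [TopologicalSpace M] [ChartedSpace E M] [IsManifold 𝓘(ℝ, E) 1 M]

/-- The length `∫ F(γ(t), γ'(t)) dt` of a path for a Finsler metric. -/
noncomputable def length (F : FinslerMetric 𝓘(ℝ, E) M) (γ : ℝ → M) (a b : ℝ) : ℝ≥0∞ :=
  letI : ∀ z : M, ENorm (TangentSpace 𝓘(ℝ, E) z) := F.toENorm
  Manifold.pathELength 𝓘(ℝ, E) γ a b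

theorem length_add (F : FinslerMetric 𝓘(ℝ, E) M) (γ : ℝ → M) {a b c : ℝ} (hab : a ≤ b)
    (hbc : b ≤ c) : F.length γ a b + F.length γ b c = F.length γ a c :=
  letI : ∀ z : M, ENorm (TangentSpace 𝓘(ℝ, E) z) := F.toENorm
  Manifold.pathELength_add hab hbc

theorem length_mono (F : FinslerMetric 𝓘(ℝ, E) M) (γ : ℝ → M) {a b a' b' : ℝ} (ha : a' ≤ a)
    (hb : b ≤ b') : F.length γ a b ≤ F.length γ a' b' :=
  letI : ∀ z : M, ENorm (TangentSpace 𝓘(ℝ, E) z) := F.toENorm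
  Manifold.pathELength_mono ha hb

theorem length_congr (F : FinslerMetric 𝓘(ℝ, E) M) {γ γ' : ℝ → M} {a b : ℝ}
    (h : EqOn γ γ' (Icc a b)) : F.length γ a b = F.length γ' a b :=
  letI : ∀ z : M, ENorm (TangentSpace 𝓘(ℝ, E) z) := F.toENorm
  Manifold.pathELength_congr h

theorem finslerEDist_le_length (F : FinslerMetric 𝓘(ℝ, E) M) {γ : ℝ → M} {a b : ℝ}
    (hγ : ContMDiffOn 𝓘(ℝ, ℝ) 𝓘(ℝ, E) 1 γ (Icc a b)) (hab : a ≤ b) :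
    F.finslerEDist (γ a) (γ b) ≤ F.length γ a b := by
  let _ : ∀ z : M, ENorm (TangentSpace 𝓘(ℝ, E) z) := F.toENorm
  -- Homogeneity of the norms makes the length invariant under reparametrization to `[0, 1]`.
  have : ∀ z : M, ENormSMulClass ℝ (TangentSpace 𝓘(ℝ, E) z) := fun z => ⟨fun c v => by
    change ENNReal.ofReal (F.norm z (c • v)) = ‖c‖ₑ * ENNReal.ofReal (F.norm z v)
    rw [map_smul_eq_mul, ENNReal.ofReal_mul (norm_nonneg c), ofReal_norm]⟩
  exact Manifold.riemannianEDist_le_pathELength hγ rfl rfl hab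

theorem exists_length_lt (F : FinslerMetric 𝓘(ℝ, E) M) {x y : M} {r : ℝ≥0∞}
    (h : F.finslerEDist x y < r) :
    ∃ γ : ℝ → M, γ 0 = x ∧ γ 1 = y ∧ ContMDiffOn 𝓘(ℝ, ℝ) 𝓘(ℝ, E) 1 γ (Icc 0 1) ∧
      F.length γ 0 1 < r :=
  letI : ∀ z : M, ENorm (TangentSpace 𝓘(ℝ, E) z) := F.toENorm
  Manifold.exists_lt_of_riemannianEDist_lt h

/-- A Finsler metric read in the chart around `x₀`: the norm of the tangent vector which has base
point `z` and coordinates `w` in this chart. -/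
noncomputable def chartNorm (F : FinslerMetric 𝓘(ℝ, E) M) (x₀ : M) (z w : E) : ℝ :=
  F.norm ((extChartAt 𝓘(ℝ, E) x₀).symm z)
    (mfderiv 𝓘(ℝ, E) 𝓘(ℝ, E) (extChartAt 𝓘(ℝ, E) x₀).symm z w)

theorem chartNorm_smul (F : FinslerMetric 𝓘(ℝ, E) M) (x₀ : M) (c : ℝ) (z w : E) :
    F.chartNorm x₀ z (c • w) = |c| * F.chartNorm x₀ z w := by
  have h : mfderiv 𝓘(ℝ, E) 𝓘(ℝ, E) (extChartAt 𝓘(ℝ, E) x₀).symm z (c • w) =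
      c • mfderiv 𝓘(ℝ, E) 𝓘(ℝ, E) (extChartAt 𝓘(ℝ, E) x₀).symm z w :=
    map_smul (mfderiv 𝓘(ℝ, E) 𝓘(ℝ, E) (extChartAt 𝓘(ℝ, E) x₀).symm z) c w
  rw [chartNorm, h, map_smul_eq_mul, Real.norm_eq_abs, chartNorm]

theorem chartNorm_pos (F : FinslerMetric 𝓘(ℝ, E) M) (x₀ : M) {z w : E}
    (hz : z ∈ (extChartAt 𝓘(ℝ, E) x₀).target) (hw : w ≠ 0) : 0 < F.chartNorm x₀ z w := by
  apply F.pos_of_ne_zero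
  have h := (isInvertible_mfderivWithin_extChartAt_symm hz).injective
  rw [modelWithCornersSelf_coe, range_id, mfderivWithin_univ] at h
  intro h0
  exact hw (h (h0.trans (map_zero _).symm))

theorem continuousOn_chartNorm (F : FinslerMetric 𝓘(ℝ, E) M) (x₀ : M) :
    ContinuousOn (fun q : E × E => F.chartNorm x₀ q.1 q.2)
      ((extChartAt 𝓘(ℝ, E) x₀).target ×ˢ univ) := by
  have hopen : IsOpen (extChartAt 𝓘(ℝ, E) x₀).target := isOpen_extChartAt_target x₀
  have h1 := (contMDiffOn_extChartAt_symm (I := 𝓘(ℝ, E)) (n := 1) x₀).continuousOn_tangentMapWithin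
    le_rfl hopen.uniqueMDiffOn
  have h2 := F.continuous_norm.comp_continuousOn h1
  have h3 := h2.comp (tangentBundleModelSpaceHomeomorph 𝓘(ℝ, E)).symm.continuous.continuousOn
    (s := (extChartAt 𝓘(ℝ, E) x₀).target ×ˢ univ) (fun q hq => hq.1)
  refine h3.congr fun q hq => ?_
  simp only [Function.comp_apply, tangentMapWithin, chartNorm]
  have : mfderivWithin 𝓘(ℝ, E) 𝓘(ℝ, E) (extChartAt 𝓘(ℝ, E) x₀).symm
      (extChartAt 𝓘(ℝ, E) x₀).target q.1 =
      mfderiv 𝓘(ℝ, E) 𝓘(ℝ, E) (extChartAt 𝓘(ℝ, E) x₀).symm q.1 :=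
    mfderivWithin_of_isOpen hopen hq.1
  rw [← this]
  rfl

/-- Near the base point of a chart, a Finsler metric is comparable with the norm of the model
space. -/
theorem exists_chartNorm_bounds [FiniteDimensional ℝ E] [Nontrivial E]
    (F : FinslerMetric 𝓘(ℝ, E) M) (x₀ : M) :
    ∃ ρ c C : ℝ, 0 < ρ ∧ 0 < c ∧ 0 < C ∧
      Metric.closedBall (extChartAt 𝓘(ℝ, E) x₀ x₀) ρ ⊆ (extChartAt 𝓘(ℝ, E) x₀).target ∧
      ∀ z ∈ Metric.closedBall (extChartAt 𝓘(ℝ, E) x₀ x₀) ρ, ∀ w : E,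
        c * ‖w‖ ≤ F.chartNorm x₀ z w ∧ F.chartNorm x₀ z w ≤ C * ‖w‖ := by
  have : ProperSpace E := FiniteDimensional.proper ℝ E
  obtain ⟨ρ, hρ, hsub⟩ := Metric.nhds_basis_closedBall.mem_iff.1
    (extChartAt_target_mem_nhds (I := 𝓘(ℝ, E)) x₀)
  -- By homogeneity it suffices to bound the norm on unit vectors, which form a compact set.
  have hK : IsCompact (Metric.closedBall (extChartAt 𝓘(ℝ, E) x₀ x₀) ρ ×ˢ
      Metric.sphere (0 : E) 1) := (isCompact_closedBall _ _).prod (isCompact_sphere _ _)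
  have hne : (Metric.closedBall (extChartAt 𝓘(ℝ, E) x₀ x₀) ρ ×ˢ
      Metric.sphere (0 : E) 1).Nonempty :=
    (Metric.nonempty_closedBall.2 hρ.le).prod (NormedSpace.sphere_nonempty.2 zero_le_one)
  have hc := (F.continuousOn_chartNorm x₀).mono (prod_mono hsub (subset_univ _))
    |>.mono (prod_mono_right (subset_univ (Metric.sphere (0 : E) 1)))
  obtain ⟨q, hq, hmin⟩ := hK.exists_isMinOn hne hc
  obtain ⟨q', hq', hmax⟩ := hK.exists_isMaxOn hne hc
  have hqpos : ∀ q ∈ Metric.closedBall (extChartAt 𝓘(ℝ, E) x₀ x₀) ρ ×ˢ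
      Metric.sphere (0 : E) 1, 0 < F.chartNorm x₀ q.1 q.2 := fun q hq =>
    F.chartNorm_pos x₀ (hsub hq.1) (ne_zero_of_mem_unit_sphere ⟨q.2, hq.2⟩)
  refine ⟨ρ, _, _, hρ, hqpos q hq, hqpos q' hq', hsub, fun z hz w => ?_⟩
  rcases eq_or_ne w 0 with rfl | hw
  · have := F.chartNorm_smul x₀ 0 z 0
    simp only [zero_smul, abs_zero, zero_mul] at this
    simp [this]
  have hw' : 0 < ‖w‖ := norm_pos_iff.2 hw
  have hmem : (z, ‖w‖⁻¹ • w) ∈ Metric.closedBall (extChartAt 𝓘(ℝ, E) x₀ x₀) ρ ×ˢ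
      Metric.sphere (0 : E) 1 := ⟨hz, by simp [norm_smul, hw'.ne']⟩
  have h1 : F.chartNorm x₀ z w = F.chartNorm x₀ z (‖w‖⁻¹ • w) * ‖w‖ := by
    rw [chartNorm_smul, abs_of_pos (inv_pos.2 hw')]
    field_simp
  rw [h1]
  exact ⟨mul_le_mul_of_nonneg_right (hmin hmem) hw'.le,
    mul_le_mul_of_nonneg_right (hmax hmem) hw'.le⟩

/-- The length of a `C^1` path, computed in a chart. -/
theorem length_extChartAt_symm_comp (F : FinslerMetric 𝓘(ℝ, E) M) (x₀ : M) {η : ℝ → E}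
    {a b : ℝ} (hab : a < b) (hη : ContDiffOn ℝ 1 η (Icc a b))
    (hmaps : MapsTo η (Icc a b) (extChartAt 𝓘(ℝ, E) x₀).target) :
    F.length ((extChartAt 𝓘(ℝ, E) x₀).symm ∘ η) a b =
      ∫⁻ t in Icc a b, ENNReal.ofReal (F.chartNorm x₀ (η t) (derivWithin η (Icc a b) t)) := by
  let _ : ∀ z : M, ENorm (TangentSpace 𝓘(ℝ, E) z) := F.toENorm
  have hopen : IsOpen (extChartAt 𝓘(ℝ, E) x₀).target := isOpen_extChartAt_target x₀
  rw [length, Manifold.pathELength_eq_lintegral_mfderivWithin_Icc]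
  refine setLIntegral_congr_fun measurableSet_Icc fun t ht => ?_
  have h1 : mfderivWithin 𝓘(ℝ, ℝ) 𝓘(ℝ, E) ((extChartAt 𝓘(ℝ, E) x₀).symm ∘ η) (Icc a b) t =
      (mfderivWithin 𝓘(ℝ, E) 𝓘(ℝ, E) (extChartAt 𝓘(ℝ, E) x₀).symm
        (extChartAt 𝓘(ℝ, E) x₀).target (η t)).comp
        (mfderivWithin 𝓘(ℝ, ℝ) 𝓘(ℝ, E) η (Icc a b) t) := by
    apply mfderivWithin_comp
    · exact (contMDiffOn_extChartAt_symm (n := 1) x₀).mdifferentiableOn one_ne_zero _ (hmaps ht)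
    · exact (hη.differentiableOn one_ne_zero t ht).mdifferentiableWithinAt
    · exact hmaps
    · rw [uniqueMDiffWithinAt_iff_uniqueDiffWithinAt]
      exact uniqueDiffOn_Icc hab _ ht
  have h2 : mfderivWithin 𝓘(ℝ, ℝ) 𝓘(ℝ, E) ((extChartAt 𝓘(ℝ, E) x₀).symm ∘ η) (Icc a b) t 1 =
      mfderiv 𝓘(ℝ, E) 𝓘(ℝ, E) (extChartAt 𝓘(ℝ, E) x₀).symm (η t)
        (derivWithin η (Icc a b) t) := by
    rw [h1, mfderivWithin_of_isOpen hopen (hmaps ht), mfderivWithin_eq_fderivWithin]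
    rfl
  change ENNReal.ofReal (F.norm _ (mfderivWithin 𝓘(ℝ, ℝ) 𝓘(ℝ, E)
    ((extChartAt 𝓘(ℝ, E) x₀).symm ∘ η) (Icc a b) t 1)) = _
  rw [h2]
  rfl

end Chart

/-! ### Invariance of the distance under left translations -/

section LeftInvariant

variable {E : Type*} [NormedAddCommGroup E] [NormedSpace ℝ E]
  {G : Type*} [TopologicalSpace G] [ChartedSpace E G] [Group G] [LieGroup 𝓘(ℝ, E) ∞ G]

theorem IsLeftInvariant.length_mul_left {F : FinslerMetric 𝓘(ℝ, E) G} (hF : F.IsLeftInvariant)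
    (a : G) {γ : ℝ → G} {s t : ℝ} (hst : s < t)
    (hγ : ContMDiffOn 𝓘(ℝ, ℝ) 𝓘(ℝ, E) 1 γ (Icc s t)) :
    F.length (fun τ => a * γ τ) s t = F.length γ s t := by
  let _ : ∀ z : G, ENorm (TangentSpace 𝓘(ℝ, E) z) := F.toENorm
  rw [length, length, Manifold.pathELength_eq_lintegral_mfderivWithin_Icc,
    Manifold.pathELength_eq_lintegral_mfderivWithin_Icc]
  refine setLIntegral_congr_fun measurableSet_Icc fun τ hτ => ?_
  have h1 : mfderivWithin 𝓘(ℝ, ℝ) 𝓘(ℝ, E) ((fun z : G => a * z) ∘ γ) (Icc s t) τ =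
      (mfderiv 𝓘(ℝ, E) 𝓘(ℝ, E) (fun z : G => a * z) (γ τ)).comp
        (mfderivWithin 𝓘(ℝ, ℝ) 𝓘(ℝ, E) γ (Icc s t) τ) := by
    apply mfderiv_comp_mfderivWithin
    · exact (contMDiff_mul_left (I := 𝓘(ℝ, E)) (n := ∞) (a := a)).mdifferentiable
        (by simp) _
    · exact hγ.mdifferentiableOn one_ne_zero _ hτ
    · rw [uniqueMDiffWithinAt_iff_uniqueDiffWithinAt]
      exact uniqueDiffOn_Icc hst _ hτ
  change ENNReal.ofReal (F.norm (a * γ τ) (mfderivWithin 𝓘(ℝ, ℝ) 𝓘(ℝ, E)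
    ((fun z : G => a * z) ∘ γ) (Icc s t) τ 1)) = ENNReal.ofReal (F.norm (γ τ) _)
  rw [h1, ← hF a (γ τ)]
  rfl

theorem IsLeftInvariant.finslerEDist_mul_left {F : FinslerMetric 𝓘(ℝ, E) G}
    (hF : F.IsLeftInvariant) (a x y : G) :
    F.finslerEDist (a * x) (a * y) = F.finslerEDist x y := by
  have key : ∀ a x y : G, F.finslerEDist (a * x) (a * y) ≤ F.finslerEDist x y := by
    intro a x y
    refine le_of_forall_gt fun r hr => ?_
    obtain ⟨γ, rfl, rfl, hγ, hlen⟩ := F.exists_length_lt hr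
    refine lt_of_le_of_lt ?_ hlen
    rw [← hF.length_mul_left a zero_lt_one hγ]
    refine F.finslerEDist_le_length (γ := fun τ => a * γ τ) ?_ zero_le_one
    exact ((contMDiff_mul_left (I := 𝓘(ℝ, E)) (n := ∞) (a := a)).of_le
      (by norm_cast)).comp_contMDiffOn hγ
  refine le_antisymm (key a x y) ?_
  simpa using key a⁻¹ (a * x) (a * y)

end LeftInvariant

/-! ### Bilipschitz parametrizations -/

section EMetric

variable {E : Type*} [NormedAddCommGroup E] [NormedSpace ℝ E]
  {M : Type*} [EMetricSpace M] [ChartedSpace E M] [IsManifold 𝓘(ℝ, E) 1 M]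

/-- If the distance of a manifold comes from a Finsler metric, then the inverse of a chart is
bilipschitz on a small ball. -/
theorem exists_bilipschitz_extChartAt_symm [FiniteDimensional ℝ E] [Nontrivial E]
    (F : FinslerMetric 𝓘(ℝ, E) M) (hd : ∀ x y : M, edist x y = F.finslerEDist x y) (x₀ : M) :
    ∃ ρ c C : ℝ, 0 < ρ ∧ 0 < c ∧ 0 < C ∧
      Metric.closedBall (extChartAt 𝓘(ℝ, E) x₀ x₀) ρ ⊆ (extChartAt 𝓘(ℝ, E) x₀).target ∧
      ∀ z ∈ Metric.closedBall (extChartAt 𝓘(ℝ, E) x₀ x₀) ρ,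
      ∀ z' ∈ Metric.closedBall (extChartAt 𝓘(ℝ, E) x₀ x₀) ρ,
        ENNReal.ofReal c * edist z z' ≤
          edist ((extChartAt 𝓘(ℝ, E) x₀).symm z) ((extChartAt 𝓘(ℝ, E) x₀).symm z') ∧
        edist ((extChartAt 𝓘(ℝ, E) x₀).symm z) ((extChartAt 𝓘(ℝ, E) x₀).symm z') ≤
          ENNReal.ofReal C * edist z z' := by
  obtain ⟨ρ₀, c, C, hρ₀, hc, hC, hsub, hbd⟩ := F.exists_chartNorm_bounds x₀
  set φ := extChartAt 𝓘(ℝ, E) x₀ with hφ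
  have hU : φ.source ∩ φ ⁻¹' Metric.closedBall (φ x₀) ρ₀ ∈ 𝓝 x₀ :=
    Filter.inter_mem (extChartAt_source_mem_nhds x₀)
      ((continuousAt_extChartAt x₀).preimage_mem_nhds (Metric.closedBall_mem_nhds _ hρ₀))
  obtain ⟨ε, hε, hεU⟩ := Metric.nhds_basis_eball.mem_iff.1 hU
  have hε3 : 0 < ε / 3 := ENNReal.div_pos hε.ne' (by simp)
  have hV : φ.symm ⁻¹' Metric.eball x₀ (ε / 3) ∈ 𝓝 (φ x₀) := by
    refine (continuousAt_extChartAt_symm x₀).preimage_mem_nhds ?_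
    rw [← hφ, extChartAt_to_inv]
    exact Metric.eball_mem_nhds _ hε3
  obtain ⟨ρ₁, hρ₁, hρ₁V⟩ := Metric.nhds_basis_closedBall.mem_iff.1 hV
  have hsub₀ : Metric.closedBall (φ x₀) (min ρ₀ ρ₁) ⊆ Metric.closedBall (φ x₀) ρ₀ :=
    Metric.closedBall_subset_closedBall (min_le_left _ _)
  have hsub₁ : Metric.closedBall (φ x₀) (min ρ₀ ρ₁) ⊆ Metric.closedBall (φ x₀) ρ₁ :=
    Metric.closedBall_subset_closedBall (min_le_right _ _)
  refine ⟨min ρ₀ ρ₁, c, C, lt_min hρ₀ hρ₁, hc, hC, hsub₀.trans hsub, fun z hz z' hz' => ⟨?_, ?_⟩⟩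
  · -- A path which is short enough stays in the domain where the metric is controlled.
    refine le_of_forall_gt fun r hr => ?_
    have hz₀ : edist x₀ (φ.symm z) < ε / 3 := by
      rw [edist_comm]; exact hρ₁V (hsub₁ hz)
    have hz₀' : edist x₀ (φ.symm z') < ε / 3 := by
      rw [edist_comm]; exact hρ₁V (hsub₁ hz')
    have hlt : edist (φ.symm z) (φ.symm z') < ε / 3 + ε / 3 :=
      (edist_triangle_left _ _ x₀).trans_lt (ENNReal.add_lt_add hz₀ hz₀')
    have hlt' := lt_min hr hlt
    rw [hd] at hlt'
    obtain ⟨γ, hγ0, hγ1, hγ, hlen⟩ := F.exists_length_lt hlt'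
    have hstay : ∀ t ∈ Icc (0 : ℝ) 1, γ t ∈ φ.source ∩ φ ⁻¹' Metric.closedBall (φ x₀) ρ₀ := by
      intro t ht
      refine hεU ?_
      have h1 : edist (φ.symm z) (γ t) < ε / 3 + ε / 3 := by
        rw [hd, ← hγ0]
        refine (F.finslerEDist_le_length (hγ.mono (Icc_subset_Icc_right ht.2)) ht.1).trans_lt ?_
        exact (F.length_mono γ le_rfl ht.2).trans_lt (hlen.trans_le (min_le_right _ _))
      rw [Metric.mem_eball, edist_comm]
      calc edist x₀ (γ t) ≤ edist x₀ (φ.symm z) + edist (φ.symm z) (γ t) := edist_triangle _ _ _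
        _ < ε / 3 + (ε / 3 + ε / 3) := ENNReal.add_lt_add hz₀ h1
        _ = ε := by rw [← add_assoc, ENNReal.add_thirds]
    have hη : ContDiffOn ℝ 1 (φ ∘ γ) (Icc 0 1) := by
      rw [← contMDiffOn_iff_contDiffOn]
      refine (contMDiffOn_extChartAt (I := 𝓘(ℝ, E)) (n := 1) (x := x₀)).comp hγ fun t ht => ?_
      have := (hstay t ht).1
      rwa [hφ, extChartAt_source] at this
    have hlen' : F.length γ 0 1 = F.length (φ.symm ∘ (φ ∘ γ)) 0 1 :=
      F.length_congr fun t ht => (φ.left_inv (hstay t ht).1).symm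
    rw [hφ, F.length_extChartAt_symm_comp x₀ zero_lt_one hη
      (fun t ht => φ.map_source (hstay t ht).1)] at hlen'
    refine lt_of_le_of_lt ?_ (hlen.trans_le (min_le_left _ _))
    rw [hlen', edist_comm, edist_eq_enorm_sub]
    have e0 : z = (φ ∘ γ) 0 := by
      rw [Function.comp_apply, hγ0, φ.right_inv (hsub (hsub₀ hz))]
    have e1 : z' = (φ ∘ γ) 1 := by
      rw [Function.comp_apply, hγ1, φ.right_inv (hsub (hsub₀ hz'))]
    calc ENNReal.ofReal c * ‖z' - z‖ₑ
        ≤ ENNReal.ofReal c * ∫⁻ t in Icc (0 : ℝ) 1, ‖derivWithin (φ ∘ γ) (Icc 0 1) t‖ₑ := by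
          rw [e0, e1]
          gcongr
          exact enorm_sub_le_lintegral_derivWithin_Icc_of_contDiffOn_Icc hη zero_le_one
      _ = ∫⁻ t in Icc (0 : ℝ) 1, ENNReal.ofReal c * ‖derivWithin (φ ∘ γ) (Icc 0 1) t‖ₑ :=
          (lintegral_const_mul' _ _ ENNReal.ofReal_ne_top).symm
      _ ≤ _ := by
          refine setLIntegral_mono' measurableSet_Icc fun t ht => ?_
          rw [← ofReal_norm, ← ENNReal.ofReal_mul hc.le]
          exact ENNReal.ofReal_le_ofReal (hbd _ (hstay t ht).2 _).1
  · -- The image of a segment is a path whose length is controlled.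
    set η : ℝ → E := ⇑(ContinuousAffineMap.lineMap (R := ℝ) z z') with hηdef
    have hη : ContDiffOn ℝ 1 η (Icc 0 1) := (ContinuousAffineMap.contDiff _).contDiffOn
    have hmaps : MapsTo η (Icc 0 1) (Metric.closedBall (φ x₀) ρ₀) := fun t ht =>
      hsub₀ ((convex_closedBall (φ x₀) (min ρ₀ ρ₁)).lineMap_mem hz hz' ht)
    have h0 : φ.symm z = (φ.symm ∘ η) 0 := by simp [hηdef, ContinuousAffineMap.coe_lineMap_eq]
    have h1 : φ.symm z' = (φ.symm ∘ η) 1 := by simp [hηdef, ContinuousAffineMap.coe_lineMap_eq]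
    have hsm : ContMDiffOn 𝓘(ℝ, ℝ) 𝓘(ℝ, E) 1 (φ.symm ∘ η) (Icc 0 1) :=
      (contMDiffOn_extChartAt_symm x₀).comp (contMDiffOn_iff_contDiffOn.2 hη)
        (fun t ht => hsub (hmaps ht))
    calc edist (φ.symm z) (φ.symm z') ≤ F.length (φ.symm ∘ η) 0 1 := by
          rw [hd, h0, h1]
          exact F.finslerEDist_le_length hsm zero_le_one
      _ = ∫⁻ t in Icc (0 : ℝ) 1, ENNReal.ofReal (F.chartNorm x₀ (η t)
            (derivWithin η (Icc 0 1) t)) :=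
          F.length_extChartAt_symm_comp x₀ zero_lt_one hη (fun t ht => hsub (hmaps ht))
      _ ≤ ∫⁻ t in Icc (0 : ℝ) 1, ENNReal.ofReal C * ‖derivWithin η (Icc 0 1) t‖ₑ := by
          refine setLIntegral_mono' measurableSet_Icc fun t ht => ?_
          rw [← ofReal_norm, ← ENNReal.ofReal_mul hC.le]
          exact ENNReal.ofReal_le_ofReal (hbd _ (hmaps ht) _).2
      _ = ENNReal.ofReal C * edist z z' := by
          rw [lintegral_const_mul' _ _ ENNReal.ofReal_ne_top,
            ← lintegral_fderiv_lineMap_eq_edist]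
          rfl

/-- If the distance of an `n`-dimensional manifold comes from a Finsler metric, then every point
has a neighborhood which is bilipschitz to a ball of `ℝⁿ`. Since `Fin n → ℝ` carries the supremum
norm, its Hausdorff `n`-measure is exactly the Lebesgue measure. -/
theorem exists_bilipschitz_param {n : ℕ} [FiniteDimensional ℝ E] [Nontrivial E]
    (hn : Module.finrank ℝ E = n)
    (F : FinslerMetric 𝓘(ℝ, E) M) (hd : ∀ x y : M, edist x y = F.finslerEDist x y) (x₀ : M) :
    ∃ (ψ : (Fin n → ℝ) → M) (R δ : ℝ) (K K' : ℝ≥0), 0 < R ∧ 0 < δ ∧ ψ 0 = x₀ ∧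
      LipschitzOnWith K ψ (Metric.closedBall 0 R) ∧
      (∀ a ∈ Metric.closedBall 0 R, ∀ b ∈ Metric.closedBall 0 R,
        edist a b ≤ K' * edist (ψ a) (ψ b)) ∧
      Metric.closedEBall x₀ (ENNReal.ofReal δ) ⊆ ψ '' Metric.closedBall 0 R := by
  obtain ⟨ρ, c, C, hρ, hc, hC, hsub, hbd⟩ := F.exists_bilipschitz_extChartAt_symm hd x₀
  set φ := extChartAt 𝓘(ℝ, E) x₀ with hφ
  let L : E ≃L[ℝ] (Fin n → ℝ) := ContinuousLinearEquiv.ofFinrankEq (by simp [hn])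
  have hLsymm : ∀ a b, edist (φ x₀ + L.symm a) (φ x₀ + L.symm b) ≤
      ‖(L.symm : (Fin n → ℝ) →L[ℝ] E)‖₊ * edist a b := fun a b => by
    rw [edist_add_left]
    exact (L.symm : (Fin n → ℝ) →L[ℝ] E).lipschitz a b
  have hL : ∀ a b, edist a b ≤ ‖(L : E →L[ℝ] (Fin n → ℝ))‖₊ *
      edist (φ x₀ + L.symm a) (φ x₀ + L.symm b) := fun a b => by
    rw [edist_add_left]
    simpa using (L : E →L[ℝ] (Fin n → ℝ)).lipschitz (L.symm a) (L.symm b)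
  -- The map `a ↦ φ x₀ + L.symm a` sends a small ball into the ball where `φ.symm` is bilipschitz.
  have hcont : Continuous fun a => φ x₀ + L.symm a := by fun_prop
  obtain ⟨R, hR, hRsub⟩ : ∃ R > 0, Metric.closedBall (0 : Fin n → ℝ) R ⊆
      (fun a => φ x₀ + L.symm a) ⁻¹' Metric.closedBall (φ x₀) ρ := by
    refine Metric.nhds_basis_closedBall.mem_iff.1 (hcont.continuousAt.preimage_mem_nhds ?_)
    simpa using Metric.closedBall_mem_nhds (φ x₀) hρ
  have hU : φ.source ∩ (fun y => L (φ y - φ x₀)) ⁻¹' Metric.closedBall 0 R ∈ 𝓝 x₀ := by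
    refine Filter.inter_mem (extChartAt_source_mem_nhds x₀) ?_
    have hcont' : ContinuousAt (fun y => L (φ y - φ x₀)) x₀ :=
      L.continuous.continuousAt.comp ((continuousAt_extChartAt x₀).sub continuousAt_const)
    refine hcont'.preimage_mem_nhds ?_
    simpa using Metric.closedBall_mem_nhds (0 : Fin n → ℝ) hR
  obtain ⟨ε, hε, hεU⟩ := Metric.nhds_basis_closedEBall.mem_iff.1 hU
  obtain ⟨δ, hδ, hδε⟩ : ∃ δ : ℝ, 0 < δ ∧ ENNReal.ofReal δ ≤ ε := by
    obtain ⟨δ, hδ, hδε⟩ := ENNReal.lt_iff_exists_nnreal_btwn.1 hε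
    exact ⟨δ, by exact_mod_cast hδ, by simpa using hδε.le⟩
  refine ⟨fun a => φ.symm (φ x₀ + L.symm a), R, δ,
    C.toNNReal * ‖(L.symm : (Fin n → ℝ) →L[ℝ] E)‖₊,
    ‖(L : E →L[ℝ] (Fin n → ℝ))‖₊ * (c⁻¹).toNNReal, hR, hδ, by simp [hφ], ?_, ?_, ?_⟩
  · intro a ha b hb
    refine (hbd _ (hRsub ha) _ (hRsub hb)).2.trans ?_
    rw [ENNReal.coe_mul, mul_assoc]
    exact mul_le_mul_right (hLsymm a b) _
  · intro a ha b hb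
    refine (hL a b).trans ?_
    rw [ENNReal.coe_mul, mul_assoc]
    refine mul_le_mul_right ?_ _
    have h := (hbd _ (hRsub ha) _ (hRsub hb)).1
    have hc' : ENNReal.ofReal c⁻¹ * ENNReal.ofReal c = 1 := by
      rw [← ENNReal.ofReal_mul (inv_pos.2 hc).le, inv_mul_cancel₀ hc.ne', ENNReal.ofReal_one]
    have h2 := mul_le_mul_right h (ENNReal.ofReal c⁻¹)
    rwa [← mul_assoc, hc', one_mul] at h2
  · intro y hy
    have hy' := hεU (Metric.closedEBall_subset_closedEBall hδε hy)
    exact ⟨L (φ y - φ x₀), hy'.2, by simp [φ.left_inv hy'.1]⟩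

/-- If the distance of a manifold comes from a Finsler metric, then a quantity which varies by at
most `K` between a point of `S` and a point at distance at most `δ` from it varies by at most
`(N + 1) * K` between the endpoints of a path in `S` of length at most `N * δ`. -/
theorem le_natCast_mul_of_length_le (F : FinslerMetric 𝓘(ℝ, E) M)
    (hd : ∀ x y : M, edist x y = F.finslerEDist x y) {D : M → M → ℝ≥0∞}
    (hD : ∀ x y z, D x z ≤ D x y + D y z) {γ : ℝ → M} {b : ℝ} {δ K : ℝ≥0∞} (hδ : δ ≠ (⊤ : ℝ≥0∞))
    {S : Set M} (hS : ∀ z ∈ S, ∀ w, edist z w ≤ δ → D z w ≤ K) (N : ℕ) {a : ℝ} (hab : a ≤ b)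
    (hγ : ContMDiffOn 𝓘(ℝ, ℝ) 𝓘(ℝ, E) 1 γ (Icc a b)) (hγS : ∀ t ∈ Icc a b, γ t ∈ S)
    (hlen : F.length γ a b ≤ N * δ) :
    D (γ a) (γ b) ≤ (N + 1) * K := by
  induction N generalizing a with
  | zero =>
    have h0 : edist (γ a) (γ b) ≤ δ := by
      rw [hd]
      exact (F.finslerEDist_le_length hγ hab).trans (hlen.trans (by simp))
    simpa using hS _ (hγS a (left_mem_Icc.2 hab)) _ h0
  | succ N ih =>
    by_cases h : edist (γ a) (γ b) ≤ δ
    · refine (hS _ (hγS a (left_mem_Icc.2 hab)) _ h).trans ?_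
      exact le_mul_of_one_le_left' le_add_self
    · obtain ⟨t, ht, hteq⟩ : δ ∈ (fun t => edist (γ a) (γ t)) '' Icc a b := by
        refine intermediate_value_Icc hab ?_ ⟨by simp, (not_le.1 h).le⟩
        exact (continuous_const.edist continuous_id).comp_continuousOn hγ.continuousOn
      have hsub : Icc t b ⊆ Icc a b := Icc_subset_Icc_left ht.1
      have h1 : δ ≤ F.length γ a t := by
        rw [← hteq]
        simp only [hd]
        exact F.finslerEDist_le_length (hγ.mono (Icc_subset_Icc_right ht.2)) ht.1
      have h2 : F.length γ t b ≤ N * δ := by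
        have h3 : δ + F.length γ t b ≤ δ + N * δ := by
          calc δ + F.length γ t b ≤ F.length γ a t + F.length γ t b := by gcongr
            _ ≤ _ := by
              rw [F.length_add γ ht.1 ht.2]
              refine hlen.trans (le_of_eq ?_)
              push_cast; ring
        exact (ENNReal.add_le_add_iff_left hδ).1 h3
      calc D (γ a) (γ b) ≤ D (γ a) (γ t) + D (γ t) (γ b) := hD _ _ _
        _ ≤ K + (N + 1) * K := by
          gcongr
          · exact hS _ (hγS a (left_mem_Icc.2 hab)) _ hteq.le
          · exact ih ht.2 (hγ.mono hsub) (fun s hs => hγS s (hsub hs)) h2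
        _ = _ := by push_cast; ring

end EMetric

end FinslerMetric

/-! ### Differences of extended real numbers -/

theorem absDiff_triangle (a b c : EReal) : absDiff a c ≤ absDiff a b + absDiff b c := by
  by_cases hb : b = ⊤ ∨ b = ⊥
  · rw [(absDiff_eq_top_iff a b).2 (Or.inr hb), top_add]
    exact le_top
  by_cases ha : a = ⊤ ∨ a = ⊥
  · rw [(absDiff_eq_top_iff a b).2 (Or.inl ha), top_add]
    exact le_top
  by_cases hc : c = ⊤ ∨ c = ⊥
  · rw [(absDiff_eq_top_iff b c).2 (Or.inr hc), add_top]
    exact le_top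
  push Not at ha hb hc
  lift a to ℝ using ha
  lift b to ℝ using hb
  lift c to ℝ using hc
  rw [absDiff_coe, absDiff_coe, absDiff_coe, ← ENNReal.ofReal_add (abs_nonneg _) (abs_nonneg _)]
  exact ENNReal.ofReal_le_ofReal (abs_sub_le _ _ _)

theorem absDiff_comm (a b : EReal) : absDiff a b = absDiff b a := by
  induction a <;> induction b <;> simp [absDiff, ← EReal.coe_sub, EReal.abs_def, abs_sub_comm]

/-! ### Upper gradients along Lipschitz curves -/

section Curves

variable {X : Type*} [EMetricSpace X]

theorem LipschitzOnWith.eVariationOn_Icc_le {K : ℝ≥0} {γ : ℝ → X} {a b : ℝ}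
    (hγ : LipschitzOnWith K γ (Icc a b)) :
    eVariationOn γ (Icc a b) ≤ K * ENNReal.ofReal (b - a) := by
  rcases le_total a b with hab | hab
  · have h1 := hγ.comp_eVariationOn_le (g := id) (s := Icc a b) (fun t ht => ht)
    refine h1.trans (mul_le_mul_right ?_ _)
    have h2 := (monotoneOn_id (s := Icc a b)).eVariationOn_eq (left_mem_Icc.2 hab)
      (right_mem_Icc.2 hab)
    rw [inter_self] at h2
    exact h2.le
  · rw [eVariationOn.subsingleton γ (subsingleton_Icc_of_ge hab)]
    exact zero_le

/-- The arc length of a `K`-Lipschitz curve is a `K`-Lipschitz function of the parameter, so an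
integral in the arc length parametrization is at most `K` times the integral in the parameter. -/
theorem arcLengthIntegral_le_of_lipschitzOnWith {K : ℝ≥0} {γ : ℝ → X} {a b : ℝ} (hab : a ≤ b)
    (hγ : LipschitzOnWith K γ (Icc a b)) (g : X → ℝ≥0∞) :
    arcLengthIntegral g γ a b ≤ K * ∫⁻ t in Icc a b, g (γ t) := by
  have hbv : LocallyBoundedVariationOn γ (Icc a b) :=
    hγ.locallyBoundedVariationOn
  have ha : a ∈ Icc a b := left_mem_Icc.2 hab
  have hb : b ∈ Icc a b := right_mem_Icc.2 hab
  set s : ℝ → ℝ := variationOnFromTo γ (Icc a b) a with hs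
  have hmono : MonotoneOn s (Icc a b) := variationOnFromTo.monotoneOn hbv ha
  have hsLip : LipschitzOnWith K s (Icc a b) := by
    have key : ∀ t ∈ Icc a b, ∀ t' ∈ Icc a b, t ≤ t' → edist (s t) (s t') ≤ K * edist t t' := by
      intro t ht t' ht' htt'
      have h1 : s t' - s t = (eVariationOn γ (Icc t t')).toReal := by
        have h2 := variationOnFromTo.add hbv ha ht ht'
        have h3 := variationOnFromTo.eq_of_le γ (Icc a b) htt'
        rw [inter_eq_right.2 (Icc_subset_Icc ht.1 ht'.2)] at h3
        simp only [hs]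
        linarith
      have h4 := (hγ.mono (Icc_subset_Icc ht.1 ht'.2)).eVariationOn_Icc_le
      rw [edist_comm, edist_dist, Real.dist_eq, h1, abs_of_nonneg ENNReal.toReal_nonneg,
        edist_comm t, edist_dist, Real.dist_eq, abs_of_nonneg (sub_nonneg.2 htt')]
      exact ENNReal.ofReal_toReal_le.trans h4
    intro t ht t' ht'
    rcases le_total t t' with h | h
    · exact key t ht t' ht' h
    · rw [edist_comm, edist_comm t]
      exact key t' ht' t ht h
  have hsa : s a = 0 := variationOnFromTo.self _ _ _
  have hsb : s b = (eVariationOn γ (Icc a b)).toReal := by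
    rw [hs, variationOnFromTo.eq_of_le _ _ hab, inter_self]
  have himage : s '' Icc a b = Icc 0 (eVariationOn γ (Icc a b)).toReal := by
    rw [hsLip.continuousOn.image_Icc_of_monotoneOn hab hmono, hsa, hsb]
  have haem : AEMeasurable s (volume.restrict (Icc a b)) :=
    hsLip.continuousOn.aemeasurable measurableSet_Icc
  have hle : volume.restrict (Icc 0 (eVariationOn γ (Icc a b)).toReal) ≤
      (K : ℝ≥0∞) • (volume.restrict (Icc a b)).map s := by
    refine Measure.le_iff.2 fun A hA => ?_
    rw [Measure.restrict_apply hA, Measure.smul_apply, Measure.map_apply_of_aemeasurable haem hA,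
      Measure.restrict_apply' measurableSet_Icc, ← himage, smul_eq_mul]
    have hsub : A ∩ s '' Icc a b ⊆ s '' (s ⁻¹' A ∩ Icc a b) := by
      rintro _ ⟨hyA, t, ht, rfl⟩
      exact ⟨t, ⟨hyA, ht⟩, rfl⟩
    refine (measure_mono hsub).trans ?_
    have := (hsLip.mono (inter_subset_right (s := s ⁻¹' A))).hausdorffMeasure_image_le
      (d := 1) zero_le_one
    rwa [hausdorffMeasure_real, ENNReal.rpow_one] at this
  calc arcLengthIntegral g γ a b
      ≤ ∫⁻ τ, g (naturalParameterization γ (Icc a b) a τ)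
          ∂((K : ℝ≥0∞) • (volume.restrict (Icc a b)).map s) := lintegral_mono' hle le_rfl
    _ = K * ∫⁻ τ, g (naturalParameterization γ (Icc a b) a τ)
          ∂((volume.restrict (Icc a b)).map s) := lintegral_smul_measure _ _
    _ ≤ K * ∫⁻ t in Icc a b, g (naturalParameterization γ (Icc a b) a (s t)) :=
        mul_le_mul_right (lintegral_map_le _ _) _
    _ = K * ∫⁻ t in Icc a b, g (γ t) := by
        congr 1
        refine setLIntegral_congr_fun measurableSet_Icc fun t ht => ?_
        simp only [hs]
        rw [edist_eq_zero.1 (edist_naturalParameterization_eq_zero hbv ha ht)]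

/-- Integrating the upper gradient along the image of a segment. -/
theorem IsUpperGradient.absDiff_le_segment [MeasurableSpace X] {n : ℕ} {u : X → EReal}
    {g : X → ℝ≥0∞}
    (hg : IsUpperGradient u g) {ψ : (Fin n → ℝ) → X} {r : ℝ} {K : ℝ≥0}
    (hLip : LipschitzOnWith K ψ (Metric.closedBall 0 r))
    (hinj : InjOn ψ (Metric.closedBall 0 r)) {c z : Fin n → ℝ}
    (hc : c ∈ Metric.closedBall 0 r) (hz : z ∈ Metric.closedBall 0 r) (hcz : z ≠ c) :
    absDiff (u (ψ c)) (u (ψ z)) ≤ ENNReal.ofReal (2 * K * r) *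
      ∫⁻ t in Icc (0 : ℝ) 1, g (ψ (AffineMap.lineMap c z t)) := by
  have hmaps : MapsTo (AffineMap.lineMap c z) (Icc (0 : ℝ) 1)
      (Metric.closedBall (0 : Fin n → ℝ) r) := fun t ht =>
    (convex_closedBall (0 : Fin n → ℝ) r).lineMap_mem hc hz ht
  have hγ : LipschitzOnWith (K * nndist c z) (fun t : ℝ => ψ (AffineMap.lineMap c z t))
      (Icc 0 1) :=
    hLip.comp (lipschitzWith_lineMap c z).lipschitzOnWith hmaps
  have h := hg.absDiff_le (fun t : ℝ => ψ (AffineMap.lineMap c z t)) 0 1 zero_le_one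
    hγ.continuousOn
    (ne_top_of_le_ne_top (ENNReal.mul_ne_top ENNReal.coe_ne_top ENNReal.ofReal_ne_top)
      hγ.eVariationOn_Icc_le)
    ⟨1, right_mem_Icc.2 zero_le_one, by
      simpa using fun h => hcz (hinj hz hc h)⟩
  simp only [AffineMap.lineMap_apply_zero, AffineMap.lineMap_apply_one] at h
  refine h.trans ((arcLengthIntegral_le_of_lipschitzOnWith zero_le_one hγ g).trans ?_)
  gcongr
  rw [← ENNReal.ofReal_coe_nnreal]
  refine ENNReal.ofReal_le_ofReal ?_
  push_cast
  have hd : dist c z ≤ r + r :=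
    (dist_triangle_right c z 0).trans (add_le_add (Metric.mem_closedBall.1 hc)
      (Metric.mem_closedBall.1 hz))
  nlinarith [mul_le_mul_of_nonneg_left hd K.coe_nonneg]

end Curves

/-! ### Averages of integrals along segments -/

section Euclidean

variable {n : ℕ}

theorem measurable_lineMap_uncurry (c : Fin n → ℝ) :
    Measurable fun q : (Fin n → ℝ) × ℝ => AffineMap.lineMap c q.1 q.2 := by
  simp only [AffineMap.lineMap_apply_module]
  fun_prop

/-- Contracting the ball with the ratio `t` towards one of its points costs a factor `t⁻ⁿ` in an
integral. -/
theorem lintegral_comp_lineMap_le {f : (Fin n → ℝ) → ℝ≥0∞} (hf : Measurable f) {r t : ℝ}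
    {c : Fin n → ℝ} (hc : c ∈ Metric.closedBall (0 : Fin n → ℝ) r) (ht : t ∈ Ioc (0 : ℝ) 1) :
    ∫⁻ z in Metric.closedBall 0 r, f (AffineMap.lineMap c z t) ≤
      ENNReal.ofReal ((t ^ n)⁻¹) * ∫⁻ z in Metric.closedBall 0 r, f z := by
  set B := Metric.closedBall (0 : Fin n → ℝ) r
  have hB : MeasurableSet B := Metric.isClosed_closedBall.measurableSet
  have hBf : Measurable (B.indicator f) := hf.indicator hB
  calc ∫⁻ z in B, f (AffineMap.lineMap c z t)
      = ∫⁻ z in B, B.indicator f (t • z + (1 - t) • c) := by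
        refine setLIntegral_congr_fun hB fun z hz => ?_
        have hmem := (convex_closedBall (0 : Fin n → ℝ) r).lineMap_mem hc hz ⟨ht.1.le, ht.2⟩
        have heq : AffineMap.lineMap c z t = t • z + (1 - t) • c := by
          rw [AffineMap.lineMap_apply_module, add_comm]
        rw [← heq, indicator_of_mem hmem]
    _ ≤ ∫⁻ z, B.indicator f (t • z + (1 - t) • c) := setLIntegral_le_lintegral _ _
    _ = ∫⁻ w, B.indicator f (w + (1 - t) • c) ∂(Measure.map (t • ·) volume) :=
        (lintegral_map (hBf.comp (measurable_add_const _)) (measurable_const_smul t)).symm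
    _ = ENNReal.ofReal ((t ^ n)⁻¹) * ∫⁻ w, B.indicator f w := by
        rw [Measure.map_addHaar_smul _ ht.1.ne', lintegral_smul_measure,
          lintegral_add_right_eq_self, Module.finrank_fin_fun, smul_eq_mul,
          abs_of_nonneg (inv_nonneg.2 (pow_nonneg ht.1.le n))]
    _ = _ := by rw [lintegral_indicator hB]

theorem lintegral_rpow_neg_eq {s : ℝ} (hs : s < 1) :
    ∫⁻ t in Icc (0 : ℝ) 1, ENNReal.ofReal (t ^ (-s)) = ENNReal.ofReal ((1 - s)⁻¹) := by
  rw [← restrict_Ioc_eq_restrict_Icc, ← ofReal_integral_eq_lintegral_ofReal]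
  · rw [← intervalIntegral.integral_of_le zero_le_one, integral_rpow (Or.inl (by linarith)),
      Real.one_rpow, Real.zero_rpow (by linarith), sub_zero, one_div]
    ring_nf
  · exact (intervalIntegrable_iff_integrableOn_Ioc_of_le zero_le_one).1
      (intervalIntegral.intervalIntegrable_rpow' (by linarith))
  · refine (ae_restrict_mem measurableSet_Ioc).mono fun t ht => ?_
    exact Real.rpow_nonneg ht.1.le _

/-- The average over `z` of the integrals along the segments from `c` to `z` is controlled by an
`Lᵖ` norm, for `p > n`: the factor `t ^ (-n / p)` from the contraction by `t` is integrable. -/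
theorem lintegral_segments_le {ρ : (Fin n → ℝ) → ℝ≥0∞} (hρ : Measurable ρ) {p r : ℝ}
    (hp : 1 < p) (hnp : n < p) {c : Fin n → ℝ} (hc : c ∈ Metric.closedBall (0 : Fin n → ℝ) r) :
    ∫⁻ z in Metric.closedBall 0 r, ∫⁻ t in Icc (0 : ℝ) 1, ρ (AffineMap.lineMap c z t) ≤
      ENNReal.ofReal ((1 - n / p)⁻¹) *
        (volume (Metric.closedBall (0 : Fin n → ℝ) r) ^ (1 - 1 / p) *
          (∫⁻ z in Metric.closedBall 0 r, ρ z ^ p) ^ (1 / p)) := by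
  set B := Metric.closedBall (0 : Fin n → ℝ) r
  have hp0 : 0 < p := one_pos.trans hp
  have hline : Measurable (Function.uncurry fun z t => ρ (AffineMap.lineMap c z t)) :=
    hρ.comp (measurable_lineMap_uncurry c)
  rw [lintegral_lintegral_swap hline.aemeasurable]
  have hbound : ∀ t ∈ Ioc (0 : ℝ) 1, ∫⁻ z in B, ρ (AffineMap.lineMap c z t) ≤
      ENNReal.ofReal (t ^ (-(n / p))) *
        (volume B ^ (1 - 1 / p) * (∫⁻ z in B, ρ z ^ p) ^ (1 / p)) := by
    intro t ht
    have hq : p.HolderConjugate p.conjExponent := Real.HolderConjugate.conjExponent hp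
    have hmeas : Measurable fun z => ρ (AffineMap.lineMap c z t) := by
      refine hρ.comp ?_
      simp only [AffineMap.lineMap_apply_module]
      fun_prop
    have hol := ENNReal.lintegral_mul_le_Lp_mul_Lq (volume.restrict B) hq
      hmeas.aemeasurable (aemeasurable_const (b := (1 : ℝ≥0∞)))
    simp only [Pi.mul_apply, mul_one, ENNReal.one_rpow, lintegral_const, one_mul,
      Measure.restrict_apply_univ] at hol
    have hexp : 1 / p.conjExponent = 1 - 1 / p := by
      rw [one_div, one_div, hq.one_sub_inv]
    rw [hexp] at hol
    refine hol.trans ?_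
    have h2 := lintegral_comp_lineMap_le (hρ.pow_const p) hc ht
    have h3 : ENNReal.ofReal ((t ^ n)⁻¹) ^ (1 / p) = ENNReal.ofReal (t ^ (-(n / p))) := by
      rw [ENNReal.ofReal_rpow_of_nonneg (inv_nonneg.2 (pow_nonneg ht.1.le n)) (by positivity),
        ← Real.rpow_natCast, ← Real.rpow_neg ht.1.le, ← Real.rpow_mul ht.1.le]
      congr 2
      ring
    calc _ ≤ (ENNReal.ofReal ((t ^ n)⁻¹) * ∫⁻ z in B, ρ z ^ p) ^ (1 / p) *
          volume B ^ (1 - 1 / p) :=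
          mul_le_mul_left (ENNReal.rpow_le_rpow h2 (by positivity)) _
      _ = _ := by
          rw [ENNReal.mul_rpow_of_nonneg _ _ (by positivity), h3]
          ring
  calc ∫⁻ t in Icc (0 : ℝ) 1, ∫⁻ z in B, ρ (AffineMap.lineMap c z t)
      ≤ ∫⁻ t in Icc (0 : ℝ) 1, ENNReal.ofReal (t ^ (-(n / p))) *
          (volume B ^ (1 - 1 / p) * (∫⁻ z in B, ρ z ^ p) ^ (1 / p)) := by
        rw [← restrict_Ioc_eq_restrict_Icc]
        exact setLIntegral_mono' measurableSet_Ioc hbound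
    _ = _ := by
        rw [lintegral_mul_const _ (by fun_prop), lintegral_rpow_neg_eq ((div_lt_one hp0).2 hnp)]

end Euclidean

/-! ### Morrey's inequality on bilipschitz balls -/

section Bilipschitz

variable {X : Type*} [EMetricSpace X] [MeasurableSpace X] [BorelSpace X] {n : ℕ}

/-- If the inverse of `ψ` is `K`-Lipschitz, then the Lebesgue measure of a set, which is its
Hausdorff `n`-measure, is at most `K ^ n` times the Hausdorff `n`-measure of its image. -/
theorem lintegral_comp_le_hausdorffMeasure {ψ : (Fin n → ℝ) → X} {B : Set (Fin n → ℝ)} {K : ℝ≥0}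
    (hB : MeasurableSet B) (hψ : ContinuousOn ψ B)
    (hanti : ∀ a ∈ B, ∀ b ∈ B, edist a b ≤ K * edist (ψ a) (ψ b)) (f : X → ℝ≥0∞)
    (hf : Measurable f) :
    ∫⁻ z in B, f (ψ z) ≤ (K : ℝ≥0∞) ^ (n : ℝ) *
      ∫⁻ x in ψ '' B, f x ∂(Measure.hausdorffMeasure (n : ℝ)) := by
  have haem : AEMeasurable ψ (volume.restrict B) := hψ.aemeasurable hB
  have hle : (volume.restrict B).map ψ ≤ ((K : ℝ≥0∞) ^ (n : ℝ)) •
      (Measure.hausdorffMeasure (n : ℝ) : Measure X).restrict (ψ '' B) := by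
    refine Measure.le_iff.2 fun S hS => ?_
    rw [Measure.map_apply_of_aemeasurable haem hS, Measure.restrict_apply' hB,
      Measure.smul_apply, Measure.restrict_apply hS, smul_eq_mul]
    set A := ψ ⁻¹' S ∩ B
    have hinj : InjOn ψ B := fun a ha b hb hab => by
      have := hanti a ha b hb
      rw [hab, edist_self, mul_zero] at this
      exact edist_eq_zero.1 (le_antisymm this zero_le)
    have hinv : ∀ a ∈ B, Function.invFunOn ψ B (ψ a) = a := fun a ha => hinj.leftInvOn_invFunOn ha
    have hLip : LipschitzOnWith K (Function.invFunOn ψ B) (ψ '' A) := by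
      rintro _ ⟨a, ha, rfl⟩ _ ⟨b, hb, rfl⟩
      rw [hinv a ha.2, hinv b hb.2]
      exact hanti a ha.2 b hb.2
    have himage : Function.invFunOn ψ B '' (ψ '' A) = A := by
      rw [image_image]
      exact (image_congr fun a ha => hinv a ha.2).trans (image_id' A)
    have hmeas := hLip.hausdorffMeasure_image_le (d := n) (Nat.cast_nonneg n)
    have hvol := hausdorffMeasure_pi_real (ι := Fin n)
    rw [Fintype.card_fin] at hvol
    rw [himage, hvol] at hmeas
    refine hmeas.trans (mul_le_mul_right (measure_mono ?_) _)
    rintro _ ⟨a, ha, rfl⟩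
    exact ⟨ha.1, mem_image_of_mem ψ ha.2⟩
  calc ∫⁻ z in B, f (ψ z) = ∫⁻ x, f x ∂((volume.restrict B).map ψ) :=
        (lintegral_map' hf.aemeasurable haem).symm
    _ ≤ _ := (lintegral_mono' hle le_rfl).trans (lintegral_smul_measure _ _).le

/-- Morrey's inequality between the center of a ball which is bilipschitz to a Euclidean ball and
another point of this ball. -/
theorem IsUpperGradient.absDiff_le_of_bilipschitz {u : X → EReal} {g : X → ℝ≥0∞}
    (hg : IsUpperGradient u g) (hn : 1 ≤ n) {p : ℝ} (hp : n < p) {ψ : (Fin n → ℝ) → X} {r : ℝ}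
    {K K' : ℝ≥0} (hr : 0 < r) (hLip : LipschitzOnWith K ψ (Metric.closedBall 0 r))
    (hanti : ∀ a ∈ Metric.closedBall 0 r, ∀ b ∈ Metric.closedBall 0 r,
      edist a b ≤ K' * edist (ψ a) (ψ b)) {b : Fin n → ℝ} (hb : b ∈ Metric.closedBall 0 r) :
    absDiff (u (ψ 0)) (u (ψ b)) ≤
      ENNReal.ofReal (4 * K * (1 - n / p)⁻¹) * (K' : ℝ≥0∞) ^ (n / p) *
        ENNReal.ofReal r ^ (1 - n / p) *
        lpNormOn (Measure.hausdorffMeasure (n : ℝ)) p (ψ '' Metric.closedBall 0 r) g := by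
  have hn1 : (1 : ℝ) ≤ n := by exact_mod_cast hn
  have hp1 : 1 < p := hn1.trans_lt hp
  have hp0 : 0 < p := one_pos.trans hp1
  have hα : 0 < 1 - n / p := sub_pos.2 ((div_lt_one hp0).2 hp)
  set B := Metric.closedBall (0 : Fin n → ℝ) r with hBdef
  have hB : MeasurableSet B := Metric.isClosed_closedBall.measurableSet
  have h0 : (0 : Fin n → ℝ) ∈ B := Metric.mem_closedBall_self hr.le
  have : Nonempty (Fin n) := ⟨⟨0, hn⟩⟩
  have hinj : InjOn ψ B := fun a ha b hb hab => by
    have := hanti a ha b hb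
    rw [hab, edist_self, mul_zero] at this
    exact edist_eq_zero.1 (le_antisymm this zero_le)
  -- Only the values of `g ∘ ψ` on the ball matter; the cut-off function is globally measurable.
  set ρ : (Fin n → ℝ) → ℝ≥0∞ := B.indicator fun z => g (ψ z) with hρdef
  have hρ : Measurable ρ := by
    classical
    have h1 : Measurable (B.piecewise ψ fun _ => ψ 0) :=
      hLip.continuousOn.measurable_piecewise continuousOn_const hB
    have h2 : ρ = B.indicator (g ∘ B.piecewise ψ fun _ => ψ 0) := by
      refine funext fun z => ?_
      by_cases hz : z ∈ B
      · simp [hρdef, hz]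
      · simp [hρdef, hz]
    rw [h2]
    exact (hg.measurable.comp h1).indicator hB
  set D := absDiff (u (ψ 0)) (u (ψ b)) with hD
  set J : (Fin n → ℝ) → ℝ≥0∞ := fun c =>
    ∫⁻ z in B, ∫⁻ t in Icc (0 : ℝ) 1, ρ (AffineMap.lineMap c z t) with hJ
  have hseg : ∀ c ∈ B, ∀ z ∈ B, z ≠ c → absDiff (u (ψ c)) (u (ψ z)) ≤
      ENNReal.ofReal (2 * K * r) * ∫⁻ t in Icc (0 : ℝ) 1, ρ (AffineMap.lineMap c z t) := by
    intro c hc z hz hcz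
    refine (hg.absDiff_le_segment hLip hinj hc hz hcz).trans_eq ?_
    congr 1
    refine setLIntegral_congr_fun measurableSet_Icc fun t ht => ?_
    exact (indicator_of_mem (f := fun z => g (ψ z))
      ((convex_closedBall (0 : Fin n → ℝ) r).lineMap_mem hc hz ht)).symm
  have hJmeas : ∀ c, Measurable fun z => ENNReal.ofReal (2 * K * r) *
      ∫⁻ t in Icc (0 : ℝ) 1, ρ (AffineMap.lineMap c z t) := fun c => by
    exact (hρ.comp (measurable_lineMap_uncurry c)).lintegral_prod_right'.const_mul _
  -- Compare `u (ψ 0)` and `u (ψ b)` with `u (ψ z)`, and average over `z` in the ball.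
  have havg : volume B * D ≤
      ENNReal.ofReal (2 * K * r) * J 0 + ENNReal.ofReal (2 * K * r) * J b := by
    calc volume B * D = ∫⁻ _ in B, D := by rw [setLIntegral_const, mul_comm]
      _ ≤ ∫⁻ z in B, (ENNReal.ofReal (2 * K * r) *
            ∫⁻ t in Icc (0 : ℝ) 1, ρ (AffineMap.lineMap 0 z t)) + ENNReal.ofReal (2 * K * r) *
            ∫⁻ t in Icc (0 : ℝ) 1, ρ (AffineMap.lineMap b z t) := by
          refine lintegral_mono_ae ?_
          filter_upwards [ae_restrict_mem hB,
            ae_restrict_of_ae (Measure.ae_ne volume (0 : Fin n → ℝ)),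
            ae_restrict_of_ae (Measure.ae_ne volume b)] with z hz hz0 hzb
          refine (absDiff_triangle _ (u (ψ z)) _).trans (add_le_add (hseg 0 h0 z hz hz0) ?_)
          rw [absDiff_comm]
          exact hseg b hb z hz hzb
      _ = _ := by
          rw [lintegral_add_left (hJmeas 0), lintegral_const_mul' _ _ ENNReal.ofReal_ne_top,
            lintegral_const_mul' _ _ ENNReal.ofReal_ne_top]
  have hvol : volume B = ENNReal.ofReal ((2 * r) ^ n) := by
    rw [hBdef, Real.volume_pi_closedBall _ hr.le, Fintype.card_fin]
  have hvol0 : volume B ≠ 0 := by rw [hvol]; simpa using pow_pos (by positivity : 0 < 2 * r) n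
  have hvolt : volume B ≠ ⊤ := by rw [hvol]; exact ENNReal.ofReal_ne_top
  set N := (∫⁻ z in B, ρ z ^ p) ^ (1 / p) with hN
  have hNle : N ≤ (K' : ℝ≥0∞) ^ (n / p) *
      lpNormOn (Measure.hausdorffMeasure (n : ℝ)) p (ψ '' B) g := by
    have h1 : ∫⁻ z in B, ρ z ^ p = ∫⁻ z in B, g (ψ z) ^ p :=
      setLIntegral_congr_fun hB fun z hz => by simp [hρdef, hz]
    have h2 := lintegral_comp_le_hausdorffMeasure hB hLip.continuousOn hanti (fun x => g x ^ p)
      (hg.measurable.pow_const p)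
    rw [hN, h1, lpNormOn]
    refine (ENNReal.rpow_le_rpow h2 (by positivity)).trans_eq ?_
    rw [ENNReal.mul_rpow_of_nonneg _ _ (by positivity), ← ENNReal.rpow_mul, mul_one_div]
  have hmain : volume B * D ≤ volume B * (ENNReal.ofReal (4 * K * (1 - n / p)⁻¹) *
      (ENNReal.ofReal r ^ (1 - n / p) * N)) := by
    have hJ0 := lintegral_segments_le hρ hp1 hp h0
    have hJb := lintegral_segments_le hρ hp1 hp hb
    rw [← hBdef] at hJ0 hJb
    refine havg.trans ((add_le_add (mul_le_mul_right hJ0 _) (mul_le_mul_right hJb _)).trans ?_)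
    have hV : volume B ^ (1 - 1 / p) ≤ volume B * ENNReal.ofReal (r ^ (-(n / p))) := by
      rw [ENNReal.rpow_sub _ _ hvol0 hvolt, ENNReal.rpow_one, div_eq_mul_inv, ← ENNReal.rpow_neg]
      refine mul_le_mul_right ?_ _
      rw [hvol, ENNReal.ofReal_rpow_of_pos (by positivity), ← Real.rpow_natCast,
        ← Real.rpow_mul (by positivity)]
      refine ENNReal.ofReal_le_ofReal ?_
      rw [show (n : ℝ) * -(1 / p) = -(n / p) by ring]
      exact Real.rpow_le_rpow_of_nonpos hr (by linarith) (by
        have : 0 ≤ n / p := by positivity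
        linarith)
    have hrr : ENNReal.ofReal r * ENNReal.ofReal (r ^ (-(n / p))) =
        ENNReal.ofReal r ^ (1 - n / p) := by
      rw [← ENNReal.ofReal_mul hr.le, ENNReal.ofReal_rpow_of_pos hr, sub_eq_add_neg,
        Real.rpow_add hr, Real.rpow_one]
    have hconst : ENNReal.ofReal (2 * K * r) * ENNReal.ofReal ((1 - n / p)⁻¹) * 2 =
        ENNReal.ofReal (4 * K * (1 - n / p)⁻¹) * ENNReal.ofReal r := by
      rw [← ENNReal.ofReal_mul (by positivity), ← ENNReal.ofReal_mul (by positivity),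
        ← ENNReal.ofReal_ofNat 2, ← ENNReal.ofReal_mul (by positivity)]
      congr 1
      ring
    calc _ = ENNReal.ofReal (2 * K * r) * ENNReal.ofReal ((1 - n / p)⁻¹) * 2 *
          (volume B ^ (1 - 1 / p) * N) := by ring
      _ ≤ ENNReal.ofReal (2 * K * r) * ENNReal.ofReal ((1 - n / p)⁻¹) * 2 *
          (volume B * ENNReal.ofReal (r ^ (-(n / p))) * N) := by gcongr
      _ = _ := by
          rw [hconst, ← hrr]
          ring
  have hDle := (ENNReal.mul_le_mul_iff_right hvol0 hvolt).1 hmain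
  refine hDle.trans ?_
  calc _ ≤ ENNReal.ofReal (4 * K * (1 - n / p)⁻¹) * (ENNReal.ofReal r ^ (1 - n / p) *
        ((K' : ℝ≥0∞) ^ (n / p) *
          lpNormOn (Measure.hausdorffMeasure (n : ℝ)) p (ψ '' B) g)) := by gcongr
    _ = _ := by ring

end Bilipschitz

/-! ### Left-invariant Finsler metrics -/

section LieGroup

theorem lpNormOn_mono {X : Type*} [MeasurableSpace X] {μ : Measure X} {p : ℝ} (hp : 0 < p)
    {A B : Set X} (h : A ⊆ B) (g : X → ℝ≥0∞) : lpNormOn μ p A g ≤ lpNormOn μ p B g :=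
  ENNReal.rpow_le_rpow (lintegral_mono_set h) (by positivity)

/-- The local form of the estimate. Left translations are isometries, so one bilipschitz
parametrization of a neighborhood of the identity serves at every point, with the same constants. -/
theorem exists_absDiff_le_of_edist_le
    {E : Type*} [NormedAddCommGroup E] [NormedSpace ℝ E] [FiniteDimensional ℝ E]
    {G : Type*} [EMetricSpace G] [ChartedSpace E G] [Group G] [LieGroup 𝓘(ℝ, E) ∞ G]
    [MeasurableSpace G] [BorelSpace G]
    {n : ℕ} (hn : 1 ≤ n) (hdim : Module.finrank ℝ E = n)
    (F : FinslerMetric 𝓘(ℝ, E) G) (hF : F.IsLeftInvariant)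
    (hd : ∀ x y : G, edist x y = F.finslerEDist x y) {p : ℝ} (hp : (n : ℝ) < p) :
    ∃ C δ : ℝ, 0 < C ∧ 0 < δ ∧
      (∀ x : G, ∃ y, y ≠ x ∧ edist x y ≤ ENNReal.ofReal δ) ∧
      ∀ (u : G → EReal) (g : G → ℝ≥0∞), IsUpperGradient u g →
        ∀ x y : G, edist x y ≤ ENNReal.ofReal δ → x ≠ y →
          absDiff (u x) (u y) ≤
            ENNReal.ofReal C * edist x y ^ (1 - (n : ℝ) / p) *
              lpNormOn (Measure.hausdorffMeasure (n : ℝ)) p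
                (Metric.closedEBall x (ENNReal.ofReal C * edist x y)) g := by
  have hp0 : 0 < p := (Nat.cast_nonneg n).trans_lt hp
  have hα : 0 < 1 - n / p := sub_pos.2 ((div_lt_one hp0).2 hp)
  have : Nontrivial E := Module.nontrivial_of_finrank_pos (R := ℝ) (by omega)
  have : Nonempty (Fin n) := ⟨⟨0, hn⟩⟩
  obtain ⟨ψ, R, δ, K, K', hR, hδ, hψ0, hLip, hanti, hsurj⟩ :=
    F.exists_bilipschitz_param hdim hd (1 : G)
  have hmul : ∀ a x y : G, edist (a * x) (a * y) = edist x y := fun a x y => by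
    rw [hd, hd, hF.finslerEDist_mul_left]
  set A : ℝ := 4 * K * (1 - n / p)⁻¹ * (K' : ℝ) ^ (n / p) * (K' : ℝ) ^ (1 - n / p) with hA
  have hA0 : 0 ≤ A := by positivity
  refine ⟨A + K * K' + 1, δ, by positivity, hδ, fun x => ?_, fun u g hg x y hxy hne => ?_⟩
  · -- The points `ψ a` with `a` small and nonzero are close to the identity and distinct from it.
    set s : ℝ := min R (δ / (K + 1)) with hs
    have hs0 : 0 < s := by positivity
    set a : Fin n → ℝ := fun _ => s with ha
    have hna : ‖a‖ = s := by rw [ha, pi_norm_const, Real.norm_of_nonneg hs0.le]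
    have haR : a ∈ Metric.closedBall (0 : Fin n → ℝ) R := by
      rw [mem_closedBall_zero_iff, hna]; exact min_le_left _ _
    have h0R : (0 : Fin n → ℝ) ∈ Metric.closedBall (0 : Fin n → ℝ) R :=
      Metric.mem_closedBall_self hR.le
    have hed : edist (0 : Fin n → ℝ) a = ENNReal.ofReal s := by
      rw [edist_dist, dist_zero_left, hna]
    refine ⟨x * ψ a, fun h => ?_, ?_⟩
    · have h1 : ψ a = 1 := by simpa using h
      have h2 := hanti 0 h0R a haR
      rw [hψ0, h1, edist_self, mul_zero, hed] at h2
      exact absurd h2 (not_le.2 (ENNReal.ofReal_pos.2 hs0))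
    · have h1 : edist x (x * ψ a) = edist (ψ 0) (ψ a) := by
        rw [hψ0, ← hmul x 1, mul_one]
      rw [h1]
      refine (hLip h0R haR).trans ?_
      rw [hed, ← ENNReal.ofReal_coe_nnreal, ← ENNReal.ofReal_mul K.coe_nonneg]
      refine ENNReal.ofReal_le_ofReal ?_
      calc (K : ℝ) * s ≤ (K + 1) * (δ / (K + 1)) := by
            gcongr
            · linarith
            · exact min_le_right _ _
        _ = δ := by field_simp
  · obtain ⟨b, hb, hby⟩ : x⁻¹ * y ∈ ψ '' Metric.closedBall 0 R := by
      refine hsurj ?_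
      rw [Metric.mem_closedEBall, edist_comm, ← hmul x]
      simpa using hxy
    have h0R : (0 : Fin n → ℝ) ∈ Metric.closedBall (0 : Fin n → ℝ) R :=
      Metric.mem_closedBall_self hR.le
    have hx : x * ψ 0 = x := by rw [hψ0, mul_one]
    have hy : x * ψ b = y := by rw [hby, mul_inv_cancel_left]
    set r : ℝ := ‖b‖ with hr
    have hr0 : 0 < r := by
      refine norm_pos_iff.2 fun hb0 => hne ?_
      rw [← hx, ← hy, hb0]
    have hsub : Metric.closedBall (0 : Fin n → ℝ) r ⊆ Metric.closedBall 0 R :=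
      Metric.closedBall_subset_closedBall (mem_closedBall_zero_iff.1 hb)
    have hrle : ENNReal.ofReal r ≤ K' * edist x y := by
      have h1 := hanti 0 h0R b hb
      rwa [← hmul x (ψ 0), hx, hy, edist_dist, dist_zero_left] at h1
    have hmorrey := hg.absDiff_le_of_bilipschitz hn hp (ψ := fun a => x * ψ a) (K := K)
      (K' := K') hr0 (fun a ha b hb => by rw [hmul]; exact hLip (hsub ha) (hsub hb))
      (fun a ha b hb => by rw [hmul]; exact hanti a (hsub ha) b (hsub hb))
      (mem_closedBall_zero_iff.2 le_rfl)
    simp only [hx, hy] at hmorrey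
    refine hmorrey.trans (mul_le_mul' ?_ (lpNormOn_mono hp0 ?_ g))
    · have h1 : ENNReal.ofReal r ^ (1 - n / p) ≤
          (K' : ℝ≥0∞) ^ (1 - n / p) * edist x y ^ (1 - n / p) := by
        rw [← ENNReal.mul_rpow_of_nonneg _ _ hα.le]
        exact ENNReal.rpow_le_rpow hrle hα.le
      refine (mul_le_mul_right h1 _).trans ?_
      rw [← mul_assoc]
      refine mul_le_mul_left ?_ _
      rw [← ENNReal.ofReal_coe_nnreal, ENNReal.ofReal_rpow_of_nonneg K'.coe_nonneg (by positivity),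
        ENNReal.ofReal_rpow_of_nonneg K'.coe_nonneg hα.le, ← ENNReal.ofReal_mul (by positivity),
        ← ENNReal.ofReal_mul (by positivity)]
      refine ENNReal.ofReal_le_ofReal ?_
      have : (0 : ℝ) ≤ K * K' := by positivity
      linarith
    · rintro _ ⟨a, ha, rfl⟩
      have h1 : edist (x * ψ a) x = edist (ψ a) (ψ 0) := by
        rw [← hmul x (ψ a), hx]
      rw [Metric.mem_closedEBall, h1]
      have h2 : edist a 0 ≤ ENNReal.ofReal r := by
        rw [edist_dist]
        exact ENNReal.ofReal_le_ofReal ha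
      calc edist (ψ a) (ψ 0) ≤ K * edist a 0 := hLip (hsub ha) h0R
        _ ≤ K * (K' * edist x y) := by gcongr; exact h2.trans hrle
        _ = ENNReal.ofReal (K * K') * edist x y := by
          rw [ENNReal.ofReal_mul K.coe_nonneg, ENNReal.ofReal_coe_nnreal,
            ENNReal.ofReal_coe_nnreal, mul_assoc]
        _ ≤ _ := by
          refine mul_le_mul_left (ENNReal.ofReal_le_ofReal ?_) _
          linarith

end LieGroup

theorem corollary3p2
    {E : Type*} [NormedAddCommGroup E] [NormedSpace ℝ E] [FiniteDimensional ℝ E]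
    {G : Type*} [EMetricSpace G] [ChartedSpace E G] [Group G] [LieGroup 𝓘(ℝ, E) ∞ G]
    [MeasurableSpace G] [BorelSpace G]
    (n : ℕ) (hn : 1 ≤ n) (hdim : Module.finrank ℝ E = n)
    (F : FinslerMetric 𝓘(ℝ, E) G) (hF : F.IsLeftInvariant)
    (hd : ∀ x y : G, edist x y = F.finslerEDist x y)
    (p : ℝ) (hp : (n : ℝ) < p) :
    ∃ C : ℝ, 0 < C ∧
      ∀ (u : G → EReal) (g : G → ℝ≥0∞), IsUpperGradient u g →
        lpNormOn (Measure.hausdorffMeasure (n : ℝ)) p univ g < (⊤ : ℝ≥0∞) →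
        ∀ x y : G, edist x y ≤ 1 →
          absDiff (u x) (u y) ≤
            ENNReal.ofReal C * edist x y ^ (1 - (n : ℝ) / p) *
              lpNormOn (Measure.hausdorffMeasure (n : ℝ)) p
                (Metric.closedEBall x (ENNReal.ofReal C * edist x y)) g := by
  have hp0 : 0 < p := (Nat.cast_nonneg n).trans_lt hp
  have hα : 0 < 1 - n / p := sub_pos.2 ((div_lt_one hp0).2 hp)
  obtain ⟨C, δ, hC, hδ, hnear, hloc⟩ := exists_absDiff_le_of_edist_le hn hdim F hF hd hp
  -- `N` steps of length `δ` cover a path of length `2`, and `C' * δ` bounds the radius of a ball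
  -- around `x` which contains the balls of radius `C * δ` around the points of such a path.
  obtain ⟨N, hN⟩ := exists_nat_ge (2 / δ)
  set C' : ℝ := (N + 1) * C + (2 + C * δ) / δ with hC'
  have hC'0 : 0 < C' := by positivity
  have hCC' : C ≤ C' := by
    have h1 : 0 ≤ (2 + C * δ) / δ := by positivity
    have h2 : 0 ≤ (N : ℝ) * C := by positivity
    linarith
  refine ⟨C', hC'0, fun u g hg hgp x y hxy => ?_⟩
  have hfin : ∀ A : Set G, lpNormOn (Measure.hausdorffMeasure (n : ℝ)) p A g ≠ ⊤ := fun A =>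
    ((lpNormOn_mono hp0 (subset_univ A) g).trans_lt hgp).ne
  have hself : ∀ z, absDiff (u z) (u z) = 0 := by
    -- `u z` is finite, as it is at finite distance from the value at a nearby point.
    intro z
    obtain ⟨w, hwz, hzw⟩ := hnear z
    have h1 : absDiff (u z) (u w) ≠ ⊤ := by
      refine ne_top_of_le_ne_top (ENNReal.mul_ne_top (ENNReal.mul_ne_top ENNReal.ofReal_ne_top
        (ENNReal.rpow_ne_top_of_nonneg hα.le ?_)) (hfin _)) (hloc u g hg z w hzw hwz.symm)
      exact ne_top_of_le_ne_top ENNReal.ofReal_ne_top hzw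
    have h2 : ¬ (u z = ⊤ ∨ u z = ⊥) := fun h => h1 ((absDiff_eq_top_iff _ _).2 (Or.inl h))
    push Not at h2
    lift u z to ℝ using h2 with v
    simp [absDiff_coe]
  rcases eq_or_ne x y with rfl | hne
  · rw [hself]
    exact zero_le
  rcases le_total (edist x y) (ENNReal.ofReal δ) with hle | hle
  · refine (hloc u g hg x y hle hne).trans ?_
    have h1 := ENNReal.ofReal_le_ofReal hCC'
    exact mul_le_mul' (mul_le_mul_left h1 _)
      (lpNormOn_mono hp0 (Metric.closedEBall_subset_closedEBall (mul_le_mul_left h1 _)) g)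
  · set P := lpNormOn (Measure.hausdorffMeasure (n : ℝ)) p
      (Metric.closedEBall x (ENNReal.ofReal C' * edist x y)) g with hP
    have hlt : F.finslerEDist x y < 2 := by
      rw [← hd]
      exact hxy.trans_lt (by norm_num)
    obtain ⟨γ, hγ0, hγ1, hγ, hlen⟩ := F.exists_length_lt hlt
    have hS : ∀ z ∈ Metric.closedEBall x 2, ∀ w, edist z w ≤ ENNReal.ofReal δ →
        absDiff (u z) (u w) ≤ ENNReal.ofReal C * ENNReal.ofReal δ ^ (1 - n / p) * P := by
      intro z hz w hzw
      rcases eq_or_ne z w with rfl | hzw'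
      · rw [hself]
        exact zero_le
      refine (hloc u g hg z w hzw hzw').trans ?_
      refine mul_le_mul' (mul_le_mul_right (ENNReal.rpow_le_rpow hzw hα.le) _)
        (lpNormOn_mono hp0 (fun v hv => ?_) g)
      rw [Metric.mem_closedEBall] at hv hz ⊢
      calc edist v x ≤ edist v z + edist z x := edist_triangle _ _ _
        _ ≤ ENNReal.ofReal C * ENNReal.ofReal δ + 2 := by
          gcongr
          exact hv.trans (mul_le_mul_right hzw _)
        _ = ENNReal.ofReal ((2 + C * δ) / δ) * ENNReal.ofReal δ := by
          rw [← ENNReal.ofReal_mul hC.le, ← ENNReal.ofReal_ofNat 2,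
            ← ENNReal.ofReal_add (by positivity) (by positivity),
            ← ENNReal.ofReal_mul (by positivity)]
          congr 1
          field_simp
          ring
        _ ≤ ENNReal.ofReal C' * edist x y := by
          refine mul_le_mul' (ENNReal.ofReal_le_ofReal ?_) hle
          rw [hC']
          have : 0 ≤ (N + 1) * C := by positivity
          linarith
    have hγS : ∀ t ∈ Icc (0 : ℝ) 1, γ t ∈ Metric.closedEBall x 2 := fun t ht => by
      rw [Metric.mem_closedEBall, edist_comm, hd, ← hγ0]
      exact (F.finslerEDist_le_length (hγ.mono (Icc_subset_Icc_right ht.2)) ht.1).trans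
        ((F.length_mono γ le_rfl ht.2).trans hlen.le)
    have hlenN : F.length γ 0 1 ≤ N * ENNReal.ofReal δ := by
      refine hlen.le.trans ?_
      rw [← ENNReal.ofReal_natCast, ← ENNReal.ofReal_mul (Nat.cast_nonneg N),
        ← ENNReal.ofReal_ofNat 2]
      exact ENNReal.ofReal_le_ofReal ((div_le_iff₀ hδ).1 hN)
    have hchain := F.le_natCast_mul_of_length_le hd (D := fun z w => absDiff (u z) (u w))
      (fun _ _ _ => absDiff_triangle _ _ _) ENNReal.ofReal_ne_top hS N zero_le_one hγ hγS hlenN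
    rw [hγ0, hγ1] at hchain
    refine hchain.trans ?_
    rw [← mul_assoc, ← mul_assoc]
    refine mul_le_mul_left (mul_le_mul' ?_ (ENNReal.rpow_le_rpow hle hα.le)) _
    rw [← ENNReal.ofReal_natCast, ← ENNReal.ofReal_one,
      ← ENNReal.ofReal_add (Nat.cast_nonneg N) zero_le_one, ← ENNReal.ofReal_mul (by positivity)]
    refine ENNReal.ofReal_le_ofReal ?_
    rw [hC']
    have : 0 ≤ (2 + C * δ) / δ := by positivity
    linarith
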